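/- Let $\omega_1,\dots,\omega_n>0$, $\mathbb{T}^n=\prod_{i=1}^n(\mathbb{R}/\omega_i\mathbb{Z})$, $|\mathbb{T}^n|=\omega_1\cdots\omega_n$. Write an average-free real distribution on $\mathbb{T}^n$ as $a=\sum_{m\in\mathbb{Z}^n\setminus\{0\}}a_m e^{ik_m\cdot x}$, $k_m=(2\pi m_i/\omega_i)_{i=1}^n$. For $r\in\mathbb{R}$ let $(-\Delta)^r a=\sum_{m\neq0}|k_m|^{2r}a_m e^{ik_m\cdot x}$, and let $\dot H^{r}_{\mathrm{av}}(\mathbb{T}^n)$ be the real Hilbert space of those $a$ with $\sum_{m\ne0}|k_m|^{2r}|a_m|^2<\infty$, with inner product $((a,b))_{r}=|\mathbb{T}^n|\sum_{m\neq0}|k_m|^{2r}a_m\overline{b_m}$ (the $L^2$ pairing of $(-\Delta)^{r}a$ and $b$). Let $$TV(a)=\sup\Bigl\{-\langle a,\operatorname{div}\varphi\rangle \Bigm| \varphi\in C^\infty(\mathbb{T}^n;\mathbb{R}^n),\ |\varphi|\le1\Bigr\}\in[0,\infty].$$ For $s\in\mathbb{R}$ and $u_0\in\dot H^{-s}_{\mathrm{av}}(\mathbb{T}^n)$,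 a solution of the fractional total variation flow $u_t=(-\Delta)^s\operatorname{div}(\nabla u/|\nabla u|)$ with initial datum $u_0$ is a function $u\in C([0,\infty),\dot H^{-s}_{\mathrm{av}}(\mathbb{T}^n))$ with $u_t\in\bigcap_{\delta>0}L^2((\delta,\infty),\dot H^{-s}_{\mathrm{av}}(\mathbb{T}^n))$, $u(0)=u_0$, and $u_t(t)\in-\partial_{\dot H^{-s}_{\mathrm{av}}}TV(u(t))$ for a.e. $t>0$, where $\partial_H$ is the subdifferential in the Hilbert space $H$. For $1\le p\le\infty$, $1/p+1/p'=1$, and a distribution $w$ on $\mathbb{T}^n$, let $$\|w\|_{\dot W^{-1,p}_{\mathrm{av}}}=\sup\Bigl\{\langle w,\varphi\rangle\Bigm|\varphi\in C^1(\mathbb{T}^n),\ \int_{\mathbb{T}^n}\varphi\,dx=0,\ \|\nabla\varphi\|_{L^{p'}}\le1\Bigr\}\in[0,\infty],$$ where, if $w$ is too singular to act on all of $C^1$, only those $\varphi$ are admitted for which the Fourier series of the pairing $\langle w,\varphi\rangle$ converges absolutely. Let $s\in\mathbb{R}$ and let $u$ be a solution of the fractional total variation flow with initial datum $u_0\in\dot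 H^{-s}_{\mathrm{av}}(\mathbb{T}^n)$. Then for all $1\le p\le\infty$ and all $t\ge0$, $$\bigl\|(-\Delta)^{-s}u(t)\bigr\|_{\dot W^{-1,p}_{\mathrm{av}}}\le|\mathbb{T}^n|^{1/p}\,t+\bigl\|(-\Delta)^{-s}u_0\bigr\|_{\dot W^{-1,p}_{\mathrm{av}}}.$$ -/

import Mathlib

open scoped ENNReal
open MeasureTheory

namespace TVFlow

noncomputable section

/-- Euclidean space `ℝⁿ`. Functions on the flat torus `𝕋ⁿ = ∏ i, ℝ / ω i ℤ` are functions on `ℝⁿ`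
that are `ω i`-periodic in the `i`-th variable. -/
abbrev Rn (n : ℕ) := EuclideanSpace ℝ (Fin n)

variable {n : ℕ}

/-- Periodicity with periods `ω i` in the coordinate directions. -/
def IsPeriodic {X : Type*} (ω : Fin n → ℝ) (f : Rn n → X) : Prop :=
  ∀ (i : Fin n) (x : Rn n), f (x + EuclideanSpace.single i (ω i)) = f x

/-- The fundamental domain `∏ i, [0, ω i)` of the torus. -/
def box (ω : Fin n → ℝ) : Set (Rn n) := {x | ∀ i, x i ∈ Set.Ico 0 (ω i)}

/-- The volume `|𝕋ⁿ| = ω₁ ⋯ ωₙ`. -/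
def vol (ω : Fin n → ℝ) : ℝ := ∏ i, ω i

/-- The wave vector `k` of the Fourier mode `x ↦ exp (i k · x)` with index `m ∈ ℤⁿ`. -/
def wave (ω : Fin n → ℝ) (m : Fin n → ℤ) : Rn n :=
  WithLp.toLp 2 fun i => 2 * Real.pi * (m i : ℝ) / ω i

/-- The Fourier coefficients `|𝕋ⁿ|⁻¹ ∫ ψ(x) exp (-i k · x) dx` of a function on the torus. -/
def fourierCoef (ω : Fin n → ℝ) (ψ : Rn n → ℝ) (m : Fin n → ℤ) : ℂ :=
  ((vol ω)⁻¹ : ℝ) *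
    ∫ x in box ω, Complex.exp (-(Complex.I * (inner ℝ (wave ω m) x : ℝ))) * (ψ x : ℂ)

/-- A distribution on `𝕋ⁿ`, given as `∑ a m exp (i k · x)` by its Fourier coefficients. -/
abbrev Dist (n : ℕ) := (Fin n → ℤ) → ℂ

/-- The `m`-th term of the Fourier series of the duality pairing `⟨a, ψ⟩` of a real distribution
and a real function (so that `⟨a, ψ⟩ = ∫ a ψ dx` when `a` is a function). -/
def pairingTerm (ω : Fin n → ℝ) (a : Dist n) (ψ : Rn n → ℝ) (m : Fin n → ℤ) : ℝ :=
  vol ω * (a m * starRingEnd ℂ (fourierCoef ω ψ m)).re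

/-- The duality pairing `⟨a, ψ⟩`. -/
def pairing (ω : Fin n → ℝ) (a : Dist n) (ψ : Rn n → ℝ) : ℝ :=
  ∑' m, pairingTerm ω a ψ m

/-- The divergence of a vector field. -/
def divergence (φ : Rn n → Rn n) (x : Rn n) : ℝ :=
  ∑ i, fderiv ℝ φ x (EuclideanSpace.single i 1) i

/-- The total variation of a distribution: the supremum of `-⟨a, div φ⟩` over smooth vector
fields `φ` on the torus with `|φ| ≤ 1`. -/
def TV (ω : Fin n → ℝ) (a : Dist n) : EReal :=
  ⨆ φ : {φ : Rn n → Rn n // ContDiff ℝ (⊤ : ℕ∞) φ ∧ IsPeriodic ω φ ∧ ∀ x, ‖φ x‖ ≤ 1},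
    ((-pairing ω a (divergence φ.1) : ℝ) : EReal)

/-- The operator `(-Δ)^r` on average-free distributions. -/
def fracLap (ω : Fin n → ℝ) (r : ℝ) (a : Dist n) : Dist n := fun m =>
  if m = 0 then 0 else ((‖wave ω m‖ ^ (2 * r) : ℝ) : ℂ) * a m

/-- The homogeneous negative Sobolev norm of order `-1`, `p`: the supremum of `⟨w, φ⟩` over
average-free `C¹` functions `φ` on the torus with `‖∇φ‖_{p'} ≤ 1`. Only those `φ` are admitted
for which the pairing with the distribution `w` converges (every `φ`, if `w` has a finite
homogeneous Sobolev norm of order at least `-1`). The supremum may be infinite. -/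
def negSobolevNorm (ω : Fin n → ℝ) (p : ℝ≥0∞) (w : Dist n) : ℝ≥0∞ :=
  ⨆ φ : {φ : Rn n → ℝ // ContDiff ℝ 1 φ ∧ IsPeriodic ω φ ∧ ∫ x in box ω, φ x = 0 ∧
      eLpNorm (gradient φ) (ENNReal.conjExponent p) (volume.restrict (box ω)) ≤ 1 ∧
      Summable (pairingTerm ω w φ)},
    ENNReal.ofReal (pairing ω w φ.1)

/-! ### The real Hilbert space of average-free distributions of Sobolev order `σ` -/

/-- The coefficients `|𝕋ⁿ|^{1/2} |k|^σ a m`. -/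
def scaled (ω : Fin n → ℝ) (σ : ℝ) (a : Dist n) : Dist n := fun m =>
  ((Real.sqrt (vol ω) * ‖wave ω m‖ ^ σ : ℝ) : ℂ) * a m

lemma scaled_add (ω : Fin n → ℝ) (σ : ℝ) (a b : Dist n) :
    scaled ω σ (a + b) = scaled ω σ a + scaled ω σ b := by
  funext m; simp [scaled, mul_add]

lemma scaled_smul (ω : Fin n → ℝ) (σ : ℝ) (c : ℝ) (a : Dist n) :
    scaled ω σ (c • a) = c • scaled ω σ a := by
  funext m; simp [scaled]; ring

lemma vol_pos (ω : Fin n → ℝ) [hω : ∀ i, Fact (0 < ω i)] : 0 < vol ω :=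
  Finset.prod_pos fun i _ => (hω i).out

lemma wave_ne_zero (ω : Fin n → ℝ) [hω : ∀ i, Fact (0 < ω i)] {m : Fin n → ℤ} (hm : m ≠ 0) :
    wave ω m ≠ 0 := by
  intro h
  apply hm
  funext i
  have := congrArg (fun x : Rn n => x i) h
  have h2 := (hω i).out.ne'
  simpa [wave, h2, Real.pi_ne_zero] using this

lemma summable_iff_memℓp (ω : Fin n → ℝ) [hω : ∀ i, Fact (0 < ω i)] (σ : ℝ) (a : Dist n) :
    Summable (fun m => ‖wave ω m‖ ^ (2 * σ) * ‖a m‖ ^ 2) ↔ Memℓp (scaled ω σ a) 2 := by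
  have hv := vol_pos ω
  rw [memℓp_gen_iff (by norm_num), ← summable_mul_left_iff hv.ne']
  refine summable_congr fun m => ?_
  have h1 : 0 ≤ ‖wave ω m‖ ^ σ := by positivity
  have h2 : ‖wave ω m‖ ^ (2 * σ) = (‖wave ω m‖ ^ σ) ^ 2 := by
    rw [mul_comm, Real.rpow_mul (norm_nonneg _)]; norm_num
  simp only [scaled, norm_mul, Complex.norm_real, Real.norm_eq_abs, abs_of_nonneg h1,
    abs_of_nonneg (Real.sqrt_nonneg _), h2]
  norm_num [mul_pow, Real.sq_sqrt hv.le]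
  ring

/-- The average-free real distributions `a` with `∑ |k|^{2σ} |a m|² < ∞`. Realness is the
Hermitian symmetry of the Fourier coefficients. -/
def sobolevSubmodule (ω : Fin n → ℝ) [∀ i, Fact (0 < ω i)] (σ : ℝ) :
    Submodule ℝ (Dist n) where
  carrier := {a | a 0 = 0 ∧ (∀ m, a (-m) = starRingEnd ℂ (a m)) ∧
    Summable fun m => ‖wave ω m‖ ^ (2 * σ) * ‖a m‖ ^ 2}
  zero_mem' := by simp [summable_zero]
  add_mem' := by
    rintro a b ⟨ha0, ha1, ha2⟩ ⟨hb0, hb1, hb2⟩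
    refine ⟨by simp [ha0, hb0], fun m => by simp [ha1, hb1], ?_⟩
    rw [summable_iff_memℓp] at *
    rw [scaled_add]; exact ha2.add hb2
  smul_mem' := by
    rintro c a ⟨ha0, ha1, ha2⟩
    refine ⟨by simp [ha0], fun m => by simp [ha1], ?_⟩
    rw [summable_iff_memℓp] at *
    rw [scaled_smul]; exact ha2.const_smul c

/-- The homogeneous Sobolev space of order `σ` of average-free real distributions on `𝕋ⁿ`. -/
def HDot (ω : Fin n → ℝ) [∀ i, Fact (0 < ω i)] (σ : ℝ) : Type := sobolevSubmodule ω σ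

namespace HDot

variable {ω : Fin n → ℝ} [∀ i, Fact (0 < ω i)] {σ : ℝ}

/-- The distribution (sequence of Fourier coefficients) underlying an element of the space. -/
def coef (a : HDot ω σ) : Dist n := Subtype.val a

instance : AddCommGroup (HDot ω σ) := inferInstanceAs (AddCommGroup (sobolevSubmodule ω σ))
instance : Module ℝ (HDot ω σ) := inferInstanceAs (Module ℝ (sobolevSubmodule ω σ))

/-- The inner product `((a, b))_σ = |𝕋ⁿ| ∑ |k|^{2σ} a m conj (b m)`, that is, the `L²` inner product
of `(-Δ)^σ a` and `b`. It is real, since `a` and `b` are real distributions. -/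
def ip (a b : HDot ω σ) : ℝ :=
  vol ω * ∑' m, ‖wave ω m‖ ^ (2 * σ) * (a.coef m * starRingEnd ℂ (b.coef m)).re

/-- The linear embedding into `ℓ²`. -/
def toLp : HDot ω σ →ₗ[ℝ] lp (fun _ : Fin n → ℤ => ℂ) 2 where
  toFun a := ⟨scaled ω σ a.coef, (summable_iff_memℓp ω σ _).1 a.2.2.2⟩
  map_add' a b := Subtype.ext (scaled_add ω σ a.coef b.coef)
  map_smul' c a := Subtype.ext (scaled_smul ω σ c a.coef)

lemma toLp_apply (a : HDot ω σ) (m : Fin n → ℤ) :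
    toLp a m = ((Real.sqrt (vol ω) * ‖wave ω m‖ ^ σ : ℝ) : ℂ) * a.coef m := rfl

lemma ip_eq (a b : HDot ω σ) : ip a b = inner ℝ (toLp a) (toLp b) := by
  rw [lp.inner_eq_tsum]
  change vol ω * _ = _
  rw [← tsum_mul_left]
  refine tsum_congr fun m => ?_
  rw [toLp_apply, toLp_apply, Complex.inner]
  have h2 : ‖wave ω m‖ ^ (2 * σ) = (‖wave ω m‖ ^ σ) ^ 2 := by
    rw [mul_comm, Real.rpow_mul (norm_nonneg _)]; norm_num
  have hv : vol ω = Real.sqrt (vol ω) ^ 2 := (Real.sq_sqrt (vol_pos ω).le).symm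
  rw [h2]
  nth_rw 1 [hv]
  simp only [map_mul, Complex.conj_ofReal, Complex.mul_re, Complex.mul_im, Complex.ofReal_re,
    Complex.ofReal_im, Complex.conj_re, Complex.conj_im]
  ring

lemma coef_zero (a : HDot ω σ) : a.coef 0 = 0 := a.2.1

lemma toLp_injective : Function.Injective (toLp (ω := ω) (σ := σ)) := by
  intro a b h
  apply Subtype.ext
  funext m
  change a.coef m = b.coef m
  by_cases hm : m = 0
  · rw [hm, coef_zero, coef_zero]
  · have h1 := congrArg (fun f : lp (fun _ : Fin n → ℤ => ℂ) 2 => f m) h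
    simp only [toLp_apply] at h1
    have h2 : Real.sqrt (vol ω) * ‖wave ω m‖ ^ σ ≠ 0 :=
      (mul_pos (Real.sqrt_pos.2 (vol_pos ω))
        (Real.rpow_pos_of_pos (norm_pos_iff.2 (wave_ne_zero ω hm)) σ)).ne'
    exact mul_left_cancel₀ (Complex.ofReal_ne_zero.2 h2) h1

/-- The inner product space axioms for `ip`. -/
@[reducible] def core : InnerProductSpace.Core ℝ (HDot ω σ) where
  inner := ip
  conj_inner_symm a b := by
    simp only [ip_eq]; exact inner_conj_symm _ _
  re_inner_nonneg a := by
    rw [ip_eq]; exact inner_self_nonneg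
  add_left a b c := by
    simp only [ip_eq, map_add, inner_add_left]
  smul_left a b r := by
    simp only [ip_eq, map_smul]; exact inner_smul_left _ _ _
  definite a h := by
    rw [ip_eq] at h
    exact toLp_injective ((inner_self_eq_zero.1 h).trans (map_zero _).symm)

instance : NormedAddCommGroup (HDot ω σ) := InnerProductSpace.Core.toNormedAddCommGroup (cd := core)
instance : InnerProductSpace ℝ (HDot ω σ) := InnerProductSpace.ofCore core.toCore

lemma inner_def (a b : HDot ω σ) : inner ℝ a b = vol ω *
    ∑' m, ‖wave ω m‖ ^ (2 * σ) * (a.coef m * starRingEnd ℂ (b.coef m)).re := rfl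

/-- `toLp` as an isometry. -/
def toLpIsometry : HDot ω σ →ₗᵢ[ℝ] lp (fun _ : Fin n → ℤ => ℂ) 2 :=
  toLp.isometryOfInner fun a b => (ip_eq a b).symm

lemma range_toLp : Set.range (toLp (ω := ω) (σ := σ)) =
    {f | f 0 = 0 ∧ ∀ m, f (-m) = starRingEnd ℂ (f m)} := by
  have hw : ∀ m : Fin n → ℤ, wave ω (-m) = -wave ω m := by
    intro m; ext i; simp [wave, neg_div]
  ext f
  constructor
  · rintro ⟨a, rfl⟩
    refine ⟨by rw [toLp_apply, coef_zero, mul_zero], fun m => ?_⟩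
    have h : a.coef (-m) = starRingEnd ℂ (a.coef m) := a.2.2.1 m
    rw [toLp_apply, toLp_apply, h, hw, norm_neg, map_mul, Complex.conj_ofReal]
  · rintro ⟨h0, h1⟩
    have hc : ∀ m : Fin n → ℤ, m ≠ 0 →
        ((Real.sqrt (vol ω) * ‖wave ω m‖ ^ σ : ℝ) : ℂ) ≠ 0 := fun m hm =>
      Complex.ofReal_ne_zero.2 (mul_pos (Real.sqrt_pos.2 (vol_pos ω))
        (Real.rpow_pos_of_pos (norm_pos_iff.2 (wave_ne_zero ω hm)) σ)).ne'
    let a : Dist n := fun m => ((Real.sqrt (vol ω) * ‖wave ω m‖ ^ σ : ℝ) : ℂ)⁻¹ * f m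
    have ha : scaled ω σ a = f := by
      funext m
      by_cases hm : m = 0
      · simp [scaled, a, hm, h0]
      · exact mul_inv_cancel_left₀ (hc m hm) (f m)
    refine ⟨⟨a, by simp [a, h0], fun m => ?_, ?_⟩, Subtype.ext ha⟩
    · simp only [a, hw, norm_neg, h1, map_mul, map_inv₀, Complex.conj_ofReal]
    · rw [summable_iff_memℓp, ha]; exact f.2

instance : CompleteSpace (HDot ω σ) := by
  have hi : Isometry (toLp (ω := ω) (σ := σ)) := (toLpIsometry (ω := ω) (σ := σ)).isometry
  rw [completeSpace_iff_isComplete_range hi.isUniformInducing, range_toLp]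
  have hcont : ∀ m : Fin n → ℤ, Continuous fun f : lp (fun _ : Fin n → ℤ => ℂ) 2 => f m :=
    fun m => (lp.evalCLM ℝ (fun _ : Fin n → ℤ => ℂ) 2 m).continuous
  refine IsClosed.isComplete ?_
  rw [Set.ofPred_and, Set.ofPred_forall]
  exact (isClosed_eq (hcont 0) continuous_const).inter
    (isClosed_iInter fun m => isClosed_eq (hcont _) (Complex.continuous_conj.comp (hcont m)))

end HDot

/-- The subdifferential at `v` of a functional `E` on a real inner product space. -/
def subdifferential {H : Type*} [NormedAddCommGroup H] [InnerProductSpace ℝ H]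
    (E : H → EReal) (v : H) : Set H :=
  {f | E v < ⊤ ∧ ∀ h : H, E v + ((inner ℝ h f : ℝ) : EReal) ≤ E (v + h)}

/-- `u` is the solution of the fractional total variation flow
`u_t = (-Δ)^s div (∇u / |∇u|)` on `𝕋ⁿ` with initial datum `u₀`: with `H = HDot ω (-s)`,
`u ∈ C([0,∞), H)`, `u_t ∈ L²((δ,∞), H)` for every `δ > 0`, `u_t ∈ -∂_H TV(u)` for a.e. `t > 0`, and
`u(0) = u₀`. The function `v` is the derivative `u_t` (in the sense of vector-valued
distributions on `(0,∞)`). -/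
structure IsSolution (ω : Fin n → ℝ) [∀ i, Fact (0 < ω i)] (s : ℝ)
    (u₀ : HDot ω (-s)) (u : ℝ → HDot ω (-s)) : Prop where
  continuousOn : ContinuousOn u (Set.Ici 0)
  initial : u 0 = u₀
  flow : ∃ v : ℝ → HDot ω (-s),
    (∀ δ : ℝ, 0 < δ → MemLp v 2 (volume.restrict (Set.Ioi δ))) ∧
    (∀ t₁ t₂ : ℝ, 0 < t₁ → t₁ ≤ t₂ → u t₂ - u t₁ = ∫ τ in t₁..t₂, v τ) ∧
    ∀ᵐ t ∂volume.restrict (Set.Ioi (0 : ℝ)),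
      -v t ∈ subdifferential (fun w : HDot ω (-s) => TV ω w.coef) (u t)

end

end TVFlow

/-! For a test function `g` in the flow space, the subgradient inequality at `u` with the competitor
`u - g` reads `TV u + ((g, u_t)) ≤ TV (u - g)`. Since `TV` is subadditive, this gives `((g, u_t)) ≤
TV (-g) ≤ ∫ |∇g|`, whatever `u` is. The inner product of order `-s` is the pairing of `(-Δ)^{-s}
u_t` with `g`, so integration in time yields `⟨(-Δ)^{-s} u(t), g⟩ ≤ t ∫ |∇g| + ⟨(-Δ)^{-s} u₀, g⟩`,
and Hölder's inequality bounds `∫ |∇g|` by `|𝕋ⁿ|^{1/p}` when `‖∇g‖_{p'} ≤ 1`. This is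
`IsSolution.inner_le`, resting on `inner_le_of_neg_mem_subdifferential`, together with
`ofReal_setIntegral_norm_le`.

A `C¹` function `φ` need not lie in the flow space, and an admissible `φ` for `u(t)` need not be
admissible for `u₀`. Both problems vanish for trigonometric polynomials, so `φ` is replaced by its
Fejér means. Their kernel is nonnegative with integral one, so `‖∇φ‖_{p'}` does not increase for any
exponent, `1` and `∞` included (`eLpNorm_gradient_fejerMean_le`). Their multipliers lie in `[0, 1]`
and tend to `1`, so every absolutely convergent pairing passes to the limit
(`tendsto_pairing_fejerMean`).

Subadditivity of `TV` needs convergence of the pairings with smooth functions. It follows from the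
rapid decay of their Fourier coefficients (`HDot.summable_pairingTerm`). -/

open scoped Pointwise

namespace TVFlow

noncomputable section

variable {n : ℕ}

/-! ### The fundamental domain of the torus -/

section Domain

variable (ω : Fin n → ℝ) [hω : ∀ i, Fact (0 < ω i)]

/-- The basis of `ℝⁿ` that generates the period lattice. -/
def periodBasis : Module.Basis (Fin n) ℝ (Rn n) :=
  (EuclideanSpace.basisFun (Fin n) ℝ).toBasis.isUnitSMul (w := ω)
    fun i => (hω i).out.ne'.isUnit

lemma periodBasis_apply (i : Fin n) : periodBasis ω i = EuclideanSpace.single i (ω i) := by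
  simp only [periodBasis, Module.Basis.isUnitSMul_apply, OrthonormalBasis.coe_toBasis,
    EuclideanSpace.basisFun_apply]
  ext j
  simp

lemma periodBasis_repr (x : Rn n) (i : Fin n) : (periodBasis ω).repr x i = x i / ω i := by
  rw [periodBasis, Module.Basis.repr_isUnitSMul]
  simp [div_eq_inv_mul, Units.smul_def]

lemma box_eq_fundamentalDomain : box ω = ZSpan.fundamentalDomain (periodBasis ω) := by
  ext x
  simp only [box, Set.mem_ofPred_eq, ZSpan.mem_fundamentalDomain, periodBasis_repr, Set.mem_Ico]
  refine forall_congr' fun i => ?_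
  have := (hω i).out
  rw [div_lt_one this, le_div_iff₀ this, zero_mul]

lemma isBounded_box : Bornology.IsBounded (box ω) := by
  rw [box_eq_fundamentalDomain]
  exact ZSpan.fundamentalDomain_isBounded _

lemma volume_box : volume (box ω) = ENNReal.ofReal (vol ω) := by
  have hb : box ω = WithLp.ofLp ⁻¹' (Set.univ.pi fun i => Set.Ico 0 (ω i)) := by
    ext x; simp [box]
  rw [hb, (PiLp.volume_preserving_ofLp (Fin n)).measure_preimage
    (MeasurableSet.univ_pi fun i => measurableSet_Ico).nullMeasurableSet, Real.volume_pi_Ico]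
  simp only [sub_zero, vol]
  rw [ENNReal.ofReal_prod_of_nonneg fun i _ => (hω i).out.le]

instance : IsFiniteMeasure (volume.restrict (box ω)) :=
  ⟨by rw [Measure.restrict_apply_univ, volume_box]; exact ENNReal.ofReal_lt_top⟩

/-- The period lattice. -/
abbrev lattice : AddSubgroup (Rn n) :=
  (Submodule.span ℤ (Set.range (periodBasis ω))).toAddSubgroup

instance : Countable (lattice ω) :=
  inferInstanceAs (Countable (Submodule.span ℤ (Set.range (periodBasis ω))))

lemma isAddFundamentalDomain_box : IsAddFundamentalDomain (lattice ω) (box ω) volume := by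
  rw [box_eq_fundamentalDomain]
  exact ZSpan.isAddFundamentalDomain' _ _

variable {ω}

omit hω in
lemma IsPeriodic.comp {X Y : Type*} {f : Rn n → X} (hf : IsPeriodic ω f) (g : X → Y) :
    IsPeriodic ω fun x => g (f x) := fun i x => congrArg g (hf i x)

omit hω in
lemma IsPeriodic.comp₂ {X Y Z : Type*} {f : Rn n → X} {g : Rn n → Y} (hf : IsPeriodic ω f)
    (hg : IsPeriodic ω g) (F : X → Y → Z) : IsPeriodic ω fun x => F (f x) (g x) := fun i x => by
  simp only [hf i x, hg i x]

omit hω in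
lemma IsPeriodic.translate {X : Type*} {f : Rn n → X} (hf : IsPeriodic ω f) (y : Rn n) :
    IsPeriodic ω fun x => f (x + y) := fun i x => by
  simp only [add_right_comm x _ y, hf i]

lemma IsPeriodic.lattice_add {X : Type*} {f : Rn n → X} (hf : IsPeriodic ω f) {g : Rn n}
    (hg : g ∈ lattice ω) (x : Rn n) : f (g + x) = f x := by
  have hg' : g ∈ AddSubgroup.closure (Set.range (periodBasis ω)) := by
    rwa [← Submodule.span_int_eq_addSubgroupClosure]
  clear hg
  induction hg' using AddSubgroup.closure_induction generalizing x with
  | mem y hy =>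
    obtain ⟨i, rfl⟩ := hy
    rw [periodBasis_apply, add_comm, hf i]
  | zero => rw [zero_add]
  | add y z _ _ hy hz => rw [add_assoc, hy, hz]
  | neg y _ hy => rw [← hy (-y + x), add_neg_cancel_left]

lemma IsPeriodic.exists_bound {E : Type*} [NormedAddCommGroup E] {f : Rn n → E}
    (hf : IsPeriodic ω f) (hc : Continuous f) : ∃ C, ∀ x, ‖f x‖ ≤ C := by
  obtain ⟨C, hC⟩ := (isBounded_box ω).isCompact_closure.exists_bound_of_continuousOn
    hc.continuousOn
  refine ⟨C, fun x => ?_⟩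
  have h1 : ZSpan.fract (periodBasis ω) x ∈ box ω := by
    rw [box_eq_fundamentalDomain]; exact ZSpan.fract_mem_fundamentalDomain _ x
  have h2 : f (ZSpan.fract (periodBasis ω) x) = f x := by
    rw [ZSpan.fract_apply, sub_eq_neg_add]
    exact hf.lattice_add (neg_mem (SetLike.coe_mem _)) x
  rw [← h2]
  exact hC _ (subset_closure h1)

lemma integrableOn_box {E : Type*} [NormedAddCommGroup E] {f : Rn n → E}
    (hc : Continuous f) : IntegrableOn f (box ω) :=
  (hc.continuousOn.integrableOn_compact (isBounded_box ω).isCompact_closure).mono_set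
    subset_closure

lemma isAddFundamentalDomain_translate (y : Rn n) :
    IsAddFundamentalDomain (lattice ω) (y +ᵥ box ω) volume :=
  (isAddFundamentalDomain_box ω).vadd_of_comm y

/-- The translated box is another fundamental domain of the same lattice. -/
lemma IsPeriodic.setIntegral_translate {E : Type*} [NormedAddCommGroup E] [NormedSpace ℝ E]
    {f : Rn n → E} (hf : IsPeriodic ω f) (y : Rn n) :
    ∫ x in box ω, f (x + y) = ∫ x in box ω, f x := by
  rw [(isAddFundamentalDomain_box ω).setIntegral_eq (isAddFundamentalDomain_translate y)
    (f := f) fun g x => hf.lattice_add g.2 x]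
  have h := (measurePreserving_add_right (volume : Measure (Rn n)) y).setIntegral_preimage_emb
    (measurableEmbedding_addRight y) f (y +ᵥ box ω)
  rw [← h]
  congr 2
  ext x
  simp [Set.mem_vadd_set_iff_neg_vadd_mem, add_comm x y]

lemma IsPeriodic.setLIntegral_translate {f : Rn n → ℝ≥0∞} (hf : IsPeriodic ω f) (y : Rn n) :
    ∫⁻ x in box ω, f (x + y) = ∫⁻ x in box ω, f x := by
  rw [(isAddFundamentalDomain_box ω).setLIntegral_eq (isAddFundamentalDomain_translate y)
    f fun g x => hf.lattice_add g.2 x]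
  have h := (measurePreserving_add_right (volume : Measure (Rn n)) y).setLIntegral_comp_preimage_emb
    (measurableEmbedding_addRight y) f (y +ᵥ box ω)
  rw [← h]
  congr 2
  ext x
  simp [Set.mem_vadd_set_iff_neg_vadd_mem, add_comm x y]

/-! ### Integration by parts -/

omit hω in
lemma IsPeriodic.fderiv_right {E : Type*} [NormedAddCommGroup E] [NormedSpace ℝ E] {f : Rn n → E}
    (hf : IsPeriodic ω f) : IsPeriodic ω (fderiv ℝ f) := fun i x => by
  rw [← fderiv_comp_add_right]
  congr 1
  exact funext fun y => hf i y

/-- Differentiation under the integral sign on the torus, with a continuous weight. -/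
lemma IsPeriodic.hasFDerivAt_setIntegral {E : Type*} [NormedAddCommGroup E] [NormedSpace ℝ E]
    [CompleteSpace E] {f : Rn n → E} (hf : IsPeriodic ω f) (hf1 : ContDiff ℝ 1 f) {k : Rn n → ℝ}
    (hk : Continuous k) (x : Rn n) :
    HasFDerivAt (fun x => ∫ y in box ω, k y • f (x + y))
      (∫ y in box ω, k y • fderiv ℝ f (x + y)) x := by
  have hd : Continuous (fderiv ℝ f) := hf1.continuous_fderiv one_ne_zero
  obtain ⟨C, hC⟩ := hf.fderiv_right.exists_bound hd
  refine hasFDerivAt_integral_of_dominated_of_fderiv_le (s := Set.univ)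
    (F := fun x y => k y • f (x + y)) (F' := fun x y => k y • fderiv ℝ f (x + y))
    (bound := fun y => ‖k y‖ * C) Filter.univ_mem ?_ ?_ ?_ ?_ ?_ ?_
  · refine Filter.Eventually.of_forall fun x => ?_
    exact (hk.smul (hf1.continuous.comp (by fun_prop))).aestronglyMeasurable
  · exact integrableOn_box (hk.smul (hf1.continuous.comp (by fun_prop)))
  · exact (hk.smul (hd.comp (by fun_prop))).aestronglyMeasurable
  · refine Filter.Eventually.of_forall fun y x _ => ?_
    rw [norm_smul]
    exact mul_le_mul_of_nonneg_left (hC _) (norm_nonneg _)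
  · exact integrableOn_box (hk.norm.mul continuous_const)
  · refine Filter.Eventually.of_forall fun y x _ => ?_
    have h := (hf1.differentiable one_ne_zero (x + y)).hasFDerivAt
    exact ((hasFDerivAt_comp_add_right y).2 h).const_smul (k y)

/-- By translation invariance `x ↦ ∫ f (x + y) dy` is constant; differentiate it under the integral
sign. -/
lemma IsPeriodic.setIntegral_fderiv {E : Type*} [NormedAddCommGroup E] [NormedSpace ℝ E]
    [CompleteSpace E] {f : Rn n → E} (hf : IsPeriodic ω f) (hf1 : ContDiff ℝ 1 f) :
    ∫ y in box ω, fderiv ℝ f y = 0 := by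
  have h := hf.hasFDerivAt_setIntegral hf1 (k := fun _ => 1) continuous_const 0
  simp only [one_smul, zero_add] at h
  have h2 : (fun x => ∫ y in box ω, f (x + y)) = fun _ => ∫ y in box ω, f y := by
    funext x
    simp only [add_comm x]
    exact hf.setIntegral_translate x
  rw [h2] at h
  exact h.unique (hasFDerivAt_const _ _)

lemma continuous_divergence {ψ : Rn n → Rn n} (h1 : ContDiff ℝ 1 ψ) :
    Continuous (divergence ψ) := by
  have hd : Continuous (fderiv ℝ ψ) := h1.continuous_fderiv one_ne_zero
  unfold divergence
  fun_prop

lemma IsPeriodic.setIntegral_divergence {ψ : Rn n → Rn n} (hψ : IsPeriodic ω ψ)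
    (h1 : ContDiff ℝ 1 ψ) : ∫ x in box ω, divergence ψ x = 0 := by
  have hd : Continuous (fderiv ℝ ψ) := h1.continuous_fderiv one_ne_zero
  unfold divergence
  rw [integral_finsetSum _ fun i _ => integrableOn_box (by fun_prop)]
  refine Finset.sum_eq_zero fun i _ => ?_
  let L : (Rn n →L[ℝ] Rn n) →L[ℝ] ℝ :=
    (EuclideanSpace.proj i).comp
      (ContinuousLinearMap.apply ℝ (Rn n) (EuclideanSpace.single i (1 : ℝ)))
  have h := L.integral_comp_comm (μ := volume.restrict (box ω)) (integrableOn_box hd)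
  rw [hψ.setIntegral_fderiv h1, map_zero] at h
  exact h

omit hω in
lemma divergence_smul {g : Rn n → ℝ} {ψ : Rn n → Rn n} {x : Rn n} (hg : DifferentiableAt ℝ g x)
    (hψ : DifferentiableAt ℝ ψ x) :
    divergence (fun x => g x • ψ x) x = g x * divergence ψ x + inner ℝ (gradient g x) (ψ x) := by
  have h1 : inner ℝ (gradient g x) (ψ x) =
      ∑ i, fderiv ℝ g x (EuclideanSpace.single i 1) * ψ x i := by
    rw [gradient, InnerProductSpace.toDual_symm_apply]
    have : ψ x = ∑ i, ψ x i • EuclideanSpace.single i (1 : ℝ) := by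
      ext j
      simp [Pi.single_apply]
    nth_rw 1 [this]
    simp [mul_comm]
  rw [h1, divergence, divergence, Finset.mul_sum, ← Finset.sum_add_distrib]
  refine Finset.sum_congr rfl fun i _ => ?_
  rw [fderiv_fun_smul hg hψ]
  simp

lemma continuous_gradient {g : Rn n → ℝ} (hg : ContDiff ℝ 1 g) : Continuous (gradient g) := by
  unfold gradient
  exact (InnerProductSpace.toDual ℝ (Rn n)).symm.continuous.comp
    (hg.continuous_fderiv one_ne_zero)

lemma setIntegral_mul_divergence {g : Rn n → ℝ} {ψ : Rn n → Rn n} (hg : IsPeriodic ω g)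
    (hg1 : ContDiff ℝ 1 g) (hψ : IsPeriodic ω ψ) (hψ1 : ContDiff ℝ 1 ψ) :
    ∫ x in box ω, g x * divergence ψ x = -∫ x in box ω, inner ℝ (gradient g x) (ψ x) := by
  have h := (hg.comp₂ hψ (fun a b => a • b)).setIntegral_divergence (hg1.smul hψ1)
  have h2 : ∀ x, divergence (fun x => g x • ψ x) x =
      g x * divergence ψ x + inner ℝ (gradient g x) (ψ x) := fun x =>
    divergence_smul (hg1.differentiable one_ne_zero x) (hψ1.differentiable one_ne_zero x)
  simp only [h2] at h
  rw [integral_add (f := fun x => g x * divergence ψ x)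
    (integrableOn_box (hg1.continuous.mul (continuous_divergence hψ1)))
    (integrableOn_box ((continuous_gradient hg1).inner hψ1.continuous))] at h
  linarith

end Domain

/-! ### Characters and Fourier coefficients -/

section Fourier

lemma wave_zero (ω : Fin n → ℝ) : wave ω 0 = 0 := by
  ext i; simp [wave]

lemma wave_add (ω : Fin n → ℝ) (m l : Fin n → ℤ) : wave ω (m + l) = wave ω m + wave ω l := by
  ext i; simp [wave]; ring

lemma wave_neg (ω : Fin n → ℝ) (m : Fin n → ℤ) : wave ω (-m) = -wave ω m := by
  ext i; simp [wave, neg_div]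

/-- The Fourier mode `x ↦ exp (i k · x)` with index `m`. -/
def char (ω : Fin n → ℝ) (m : Fin n → ℤ) (x : Rn n) : ℂ :=
  Complex.exp (Complex.I * (inner ℝ (wave ω m) x : ℝ))

lemma char_zero (ω : Fin n → ℝ) (x : Rn n) : char ω 0 x = 1 := by
  simp [char, wave_zero]

lemma char_add (ω : Fin n → ℝ) (m l : Fin n → ℤ) (x : Rn n) :
    char ω (m + l) x = char ω m x * char ω l x := by
  simp [char, wave_add, inner_add_left, mul_add, Complex.exp_add]

lemma char_neg (ω : Fin n → ℝ) (m : Fin n → ℤ) (x : Rn n) :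
    char ω (-m) x = starRingEnd ℂ (char ω m x) := by
  simp [char, wave_neg, ← Complex.exp_conj]

lemma char_sub (ω : Fin n → ℝ) (m l : Fin n → ℤ) (x : Rn n) :
    char ω (m - l) x = char ω m x * starRingEnd ℂ (char ω l x) := by
  rw [sub_eq_add_neg, char_add, char_neg]

lemma char_apply_add (ω : Fin n → ℝ) (m : Fin n → ℤ) (x y : Rn n) :
    char ω m (x + y) = char ω m x * char ω m y := by
  simp [char, inner_add_right, mul_add, Complex.exp_add]

lemma char_apply_neg (ω : Fin n → ℝ) (m : Fin n → ℤ) (x : Rn n) :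
    char ω m (-x) = char ω (-m) x := by
  simp [char, wave_neg]

lemma continuous_char (ω : Fin n → ℝ) (m : Fin n → ℤ) : Continuous (char ω m) := by
  unfold char
  fun_prop

variable {ω : Fin n → ℝ} [hω : ∀ i, Fact (0 < ω i)]

lemma isPeriodic_char (m : Fin n → ℤ) : IsPeriodic ω (char ω m) := fun i x => by
  have h := (hω i).out.ne'
  have h1 : char ω m (EuclideanSpace.single i (ω i)) = 1 := by
    rw [char, Complex.exp_eq_one_iff]
    refine ⟨m i, ?_⟩
    simp only [EuclideanSpace.inner_single_right, wave, conj_trivial]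
    have h2 : ω i * (2 * Real.pi * (m i : ℝ) / ω i) = 2 * Real.pi * m i := by field_simp
    rw [h2]
    push_cast
    ring
  rw [char_apply_add, h1, mul_one]

lemma setIntegral_char (m : Fin n → ℤ) :
    ∫ x in box ω, char ω m x = if m = 0 then (vol ω : ℂ) else 0 := by
  split_ifs with h
  · subst h
    simp [char_zero, measureReal_def, volume_box, (vol_pos ω).le]
  · have hw := wave_ne_zero ω h
    -- Translation by `π k / |k|²` multiplies the mode by `exp (i π) = -1`, so the integral equals
    -- its own negative.
    have h1 := (isPeriodic_char (ω := ω) m).setIntegral_translate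
      ((Real.pi / ‖wave ω m‖ ^ 2) • wave ω m)
    have h2 : char ω m ((Real.pi / ‖wave ω m‖ ^ 2) • wave ω m) = -1 := by
      rw [char, inner_smul_right, real_inner_self_eq_norm_sq,
        div_mul_cancel₀ _ (pow_ne_zero 2 (norm_ne_zero_iff.2 hw)), mul_comm, Complex.exp_pi_mul_I]
    simp only [char_apply_add, h2, mul_neg_one, integral_neg] at h1
    exact self_eq_neg.1 h1.symm

omit hω in
lemma fourierCoef_eq (ψ : Rn n → ℝ) (m : Fin n → ℤ) :
    fourierCoef ω ψ m = ((vol ω)⁻¹ : ℝ) * ∫ x in box ω, char ω (-m) x * (ψ x : ℂ) := by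
  simp [fourierCoef, char, wave_neg]

omit hω in
lemma fourierCoef_neg (ψ : Rn n → ℝ) (m : Fin n → ℤ) :
    fourierCoef ω ψ (-m) = starRingEnd ℂ (fourierCoef ω ψ m) := by
  rw [fourierCoef_eq, fourierCoef_eq, map_mul, Complex.conj_ofReal, ← integral_conj]
  congr 2
  funext x
  rw [map_mul, Complex.conj_ofReal, char_neg ω (-m)]

omit hω in
lemma fourierCoef_zero (ψ : Rn n → ℝ) :
    fourierCoef ω ψ 0 = (((vol ω)⁻¹ * ∫ x in box ω, ψ x : ℝ) : ℂ) := by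
  rw [fourierCoef_eq]
  simp only [neg_zero, char_zero, one_mul, integral_complex_ofReal]
  push_cast
  rfl

/-! ### Trigonometric polynomials -/

/-- `g` is the trigonometric polynomial with coefficients `h`, supported in `F`. -/
structure IsTrigPoly (ω : Fin n → ℝ) (F : Finset (Fin n → ℤ)) (h : Dist n) (g : Rn n → ℝ) :
    Prop where
  eq_sum : ∀ x, (g x : ℂ) = ∑ m ∈ F, h m * char ω m x
  eq_zero : ∀ m, m ∉ F → h m = 0

namespace IsTrigPoly

variable {F : Finset (Fin n → ℤ)} {h : Dist n} {g : Rn n → ℝ}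

include hω in
lemma fourierCoef_eq (hg : IsTrigPoly ω F h g) : fourierCoef ω g = h := by
  funext l
  have hv : ((vol ω : ℝ) : ℂ) ≠ 0 := Complex.ofReal_ne_zero.2 (vol_pos ω).ne'
  have h1 : ∀ x, char ω (-l) x * (g x : ℂ) = ∑ m ∈ F, h m * char ω (m - l) x := fun x => by
    rw [hg.eq_sum, Finset.mul_sum]
    refine Finset.sum_congr rfl fun m _ => ?_
    rw [sub_eq_add_neg, char_add]
    ring
  rw [TVFlow.fourierCoef_eq]
  simp only [h1]
  rw [integral_finsetSum _ fun m _ => integrableOn_box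
    (f := fun x => h m * char ω (m - l) x) (continuous_const.mul (continuous_char ω (m - l)))]
  simp only [integral_const_mul, setIntegral_char, sub_eq_zero]
  rw [Finset.sum_eq_single l]
  · rw [if_pos rfl]
    push_cast
    field_simp
  · intro m _ hm
    rw [if_neg hm, mul_zero]
  · intro hl
    rw [hg.eq_zero l hl, zero_mul]

include hω in
lemma pairing_eq (hg : IsTrigPoly ω F h g) {f : Rn n → ℝ} (hf : Continuous f) :
    pairing ω h f = ∫ x in box ω, g x * f x := by
  have hv : ((vol ω : ℝ) : ℂ) ≠ 0 := Complex.ofReal_ne_zero.2 (vol_pos ω).ne'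
  have h1 : pairing ω h f = ∑ m ∈ F, pairingTerm ω h f m :=
    tsum_eq_sum fun m hm => by simp [pairingTerm, hg.eq_zero m hm]
  have h2 : ∀ m, pairingTerm ω h f m = (∫ x in box ω, h m * char ω m x * (f x : ℂ)).re := by
    intro m
    rw [pairingTerm, ← fourierCoef_neg, TVFlow.fourierCoef_eq, neg_neg]
    simp only [mul_assoc, integral_const_mul]
    rw [← Complex.re_ofReal_mul]
    congr 1
    push_cast
    field_simp
  have h3 : ∀ x, ((g x * f x : ℝ) : ℂ) = ∑ m ∈ F, h m * char ω m x * (f x : ℂ) := fun x => by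
    rw [Complex.ofReal_mul, hg.eq_sum, Finset.sum_mul]
  rw [h1]
  simp only [h2]
  rw [← Complex.re_sum, ← integral_finsetSum]
  · simp only [← h3]
    rw [integral_complex_ofReal, Complex.ofReal_re]
  · intro m _
    have := continuous_char ω m
    exact integrableOn_box (by fun_prop)

include hω in
lemma isPeriodic (hg : IsTrigPoly ω F h g) : IsPeriodic ω g := fun i x => by
  apply Complex.ofReal_injective
  rw [hg.eq_sum, hg.eq_sum]
  refine Finset.sum_congr rfl fun m _ => ?_
  rw [isPeriodic_char m i x]

omit hω in
lemma contDiff {k : WithTop ℕ∞} (hg : IsTrigPoly ω F h g) : ContDiff ℝ k g := by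
  have h1 : g = fun x => Complex.reCLM (∑ m ∈ F, h m * char ω m x) := by
    funext x
    rw [← hg.eq_sum]
    rfl
  rw [h1]
  refine Complex.reCLM.contDiff.comp (ContDiff.sum fun m _ => contDiff_const.mul ?_)
  unfold char
  refine Complex.contDiff_exp.comp (contDiff_const.mul ?_)
  exact Complex.ofRealCLM.contDiff.comp (contDiff_const.inner ℝ contDiff_id)

-- No decay of `w` is required: this makes `g` admissible in `negSobolevNorm` for every
-- distribution.
include hω in
lemma summable_pairingTerm (hg : IsTrigPoly ω F h g) (w : Dist n) :
    Summable (pairingTerm ω w g) :=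
  summable_of_ne_finset_zero (s := F) fun m hm => by
    simp [pairingTerm, hg.fourierCoef_eq, hg.eq_zero m hm]

end IsTrigPoly

/-! ### Fejér means -/

/-- The Fejér kernel of a finite set of indices. -/
def fejerKernel (ω : Fin n → ℝ) (S : Finset (Fin n → ℤ)) (y : Rn n) : ℝ :=
  (vol ω * S.card)⁻¹ * ‖∑ a ∈ S, char ω a y‖ ^ 2

/-- The Fejér mean of a function on the torus. -/
def fejerMean (ω : Fin n → ℝ) (S : Finset (Fin n → ℤ)) (φ : Rn n → ℝ) (x : Rn n) : ℝ :=
  ∫ y in box ω, fejerKernel ω S y • φ (x + y)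

/-- The Fourier multiplier of the Fejér mean. -/
def fejerWeight (S : Finset (Fin n → ℤ)) (m : Fin n → ℤ) : ℝ :=
  ((S ×ˢ S).filter fun q => q.2 - q.1 = m).card / S.card

variable {S : Finset (Fin n → ℤ)}

lemma fejerKernel_nonneg (y : Rn n) : 0 ≤ fejerKernel ω S y :=
  mul_nonneg (inv_nonneg.2 (mul_nonneg (vol_pos ω).le (Nat.cast_nonneg _))) (by positivity)

omit hω in
lemma continuous_fejerKernel : Continuous (fejerKernel ω S) := by
  unfold fejerKernel
  exact continuous_const.mul ((continuous_finsetSum _ fun a _ => continuous_char ω a).norm.pow 2)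

omit hω in
lemma fejerKernel_eq_sum (y : Rn n) : (fejerKernel ω S y : ℂ) =
    ((vol ω * S.card : ℝ) : ℂ)⁻¹ * ∑ q ∈ S ×ˢ S, char ω (q.1 - q.2) y := by
  rw [fejerKernel, Complex.ofReal_mul, Complex.ofReal_inv]
  congr 1
  rw [Complex.ofReal_pow, ← Complex.mul_conj', map_sum, Finset.sum_mul_sum, Finset.sum_product]
  simp only [char_sub]

lemma setIntegral_fejerKernel (hS : S.Nonempty) : ∫ y in box ω, fejerKernel ω S y = 1 := by
  apply Complex.ofReal_injective
  rw [← integral_complex_ofReal]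
  simp only [fejerKernel_eq_sum, integral_const_mul]
  rw [integral_finsetSum _ fun q _ => integrableOn_box (continuous_char ω _)]
  simp only [setIntegral_char, sub_eq_zero]
  rw [Finset.sum_product]
  have h : ∀ a ∈ S, (∑ b ∈ S, if a = b then (vol ω : ℂ) else 0) = vol ω := fun a ha => by
    rw [Finset.sum_ite_eq, if_pos ha]
  rw [Finset.sum_congr rfl h, Finset.sum_const, nsmul_eq_mul]
  have hv : ((vol ω : ℝ) : ℂ) ≠ 0 := Complex.ofReal_ne_zero.2 (vol_pos ω).ne'
  have hc : (S.card : ℂ) ≠ 0 := Nat.cast_ne_zero.2 hS.card_ne_zero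
  push_cast
  field_simp

/-- The squared modulus in the kernel expands into modes indexed by differences of elements of `S`.
Each mode, integrated against a translate of `φ`, isolates one Fourier coefficient, and
`fejerWeight` counts how often each difference occurs. -/
lemma isTrigPoly_fejerMean {φ : Rn n → ℝ} (hφ : IsPeriodic ω φ) (hc : Continuous φ) :
    IsTrigPoly ω ((S ×ˢ S).image fun q => q.2 - q.1)
      (fun m => fejerWeight S m * fourierCoef ω φ m) (fejerMean ω S φ) where
  eq_sum x := by
    have hv : ((vol ω : ℝ) : ℂ) ≠ 0 := Complex.ofReal_ne_zero.2 (vol_pos ω).ne'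
    have h1 : ∀ m, ∫ y in box ω, char ω (-m) y * (φ (x + y) : ℂ) =
        vol ω * (fourierCoef ω φ m * char ω m x) := fun m => by
      have h2 := ((isPeriodic_char (ω := ω) (-m)).comp₂ (hφ.translate x)
        (fun a b => a * (b : ℂ))).setIntegral_translate (-x)
      have h3 : ∀ y, y + -x + x = y := fun y => neg_add_cancel_right y x
      simp only [h3] at h2
      simp only [add_comm x]
      rw [← h2, TVFlow.fourierCoef_eq]
      simp only [char_apply_add, char_apply_neg, neg_neg, mul_right_comm _ (char ω m x),
        integral_mul_const]
      push_cast
      field_simp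
    have h3 : ∀ y, ((fejerKernel ω S y • φ (x + y) : ℝ) : ℂ) = ((vol ω * S.card : ℝ) : ℂ)⁻¹ *
        ∑ q ∈ S ×ˢ S, char ω (-(q.2 - q.1)) y * (φ (x + y) : ℂ) := fun y => by
      rw [smul_eq_mul, Complex.ofReal_mul, fejerKernel_eq_sum, mul_assoc, Finset.sum_mul]
      simp only [neg_sub]
    rw [fejerMean, ← integral_complex_ofReal]
    simp only [h3, integral_const_mul]
    rw [integral_finsetSum]
    · simp only [h1]
      rw [← Finset.mul_sum, Finset.sum_comp (fun m => fourierCoef ω φ m * char ω m x)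
        (fun q : (Fin n → ℤ) × (Fin n → ℤ) => q.2 - q.1), Finset.mul_sum, Finset.mul_sum]
      refine Finset.sum_congr rfl fun m _ => ?_
      rw [fejerWeight, nsmul_eq_mul]
      push_cast
      field_simp
    · intro q _
      have := continuous_char ω (-(q.2 - q.1))
      exact integrableOn_box (by fun_prop)
  eq_zero m hm := by
    have h : (S ×ˢ S).filter (fun q => q.2 - q.1 = m) = ∅ := by
      rw [Finset.filter_eq_empty_iff]
      exact fun q hq hqm => hm (Finset.mem_image.2 ⟨q, hq, hqm⟩)
    simp [fejerWeight, h]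

lemma fejerWeight_nonneg (m : Fin n → ℤ) : 0 ≤ fejerWeight S m := by
  unfold fejerWeight; positivity

/-- A pair with prescribed difference is determined by its first entry, which lies in `S`. -/
lemma fejerWeight_le_one (m : Fin n → ℤ) : fejerWeight S m ≤ 1 := by
  refine div_le_one_of_le₀ (Nat.cast_le.2 ?_) (Nat.cast_nonneg _)
  refine Finset.card_le_card_of_injOn Prod.fst (fun q hq => ?_) fun q hq r hr h => ?_
  · exact (Finset.mem_product.1 (Finset.mem_filter.1 hq).1).1
  · have h1 := (Finset.mem_filter.1 hq).2
    have h2 := (Finset.mem_filter.1 hr).2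
    refine Prod.ext h ?_
    rw [← sub_add_cancel q.2 q.1, ← sub_add_cancel r.2 r.1, h1, h2, h]

/-- The cube `{0, …, N - 1}ⁿ` of indices. -/
def cube (n N : ℕ) : Finset (Fin n → ℤ) := Fintype.piFinset fun _ => Finset.Ico 0 (N : ℤ)

lemma card_cube (N : ℕ) : (cube n N).card = N ^ n := by
  simp [cube]

lemma prod_le_fejerWeight_cube (m : Fin n → ℤ) (N : ℕ) (hm : ∀ i, |m i| ≤ N) :
    ∏ i, (((N : ℝ) - |(m i : ℝ)|) / N) ≤ fejerWeight (cube n N) m := by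
  rw [fejerWeight, card_cube, Finset.prod_div_distrib, Finset.prod_const, Finset.card_univ,
    Fintype.card_fin, Nat.cast_pow]
  refine div_le_div_of_nonneg_right ?_ (by positivity)
  -- `T` consists of the `a` for which both `a` and `a + m` lie in the cube; coordinate `i` leaves
  -- `N - |m i|` choices.
  let T : Finset (Fin n → ℤ) :=
    Fintype.piFinset fun i => Finset.Ico (max 0 (-m i)) (min (N : ℤ) (N - m i))
  have hT : (T.card : ℝ) = ∏ i, ((N : ℝ) - |(m i : ℝ)|) := by
    rw [Fintype.card_piFinset, Nat.cast_prod]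
    refine Finset.prod_congr rfl fun i _ => ?_
    have h1 : min (N : ℤ) (N - m i) - max 0 (-m i) = N - |m i| := by
      rcases abs_cases (m i) with h | h <;> omega
    have h2 : ((N - |m i|).toNat : ℤ) = N - |m i| := Int.toNat_of_nonneg (by linarith [hm i])
    rw [Int.card_Ico, h1]
    exact_mod_cast h2
  rw [← hT, Nat.cast_le]
  refine Finset.card_le_card_of_injOn (fun a => (a, a + m)) (fun a ha => ?_)
    fun a _ b _ h => congrArg Prod.fst h
  have ha' : ∀ i, max 0 (-m i) ≤ a i ∧ a i < min (N : ℤ) (N - m i) := by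
    simpa [T, Fintype.mem_piFinset] using ha
  simp only [cube, Finset.coe_filter, Finset.mem_product, Fintype.mem_piFinset, Finset.mem_Ico,
    Set.mem_ofPred_eq, Pi.add_apply, add_sub_cancel_left, and_true]
  exact ⟨fun i => by have := ha' i; omega, fun i => by have := ha' i; omega⟩

lemma tendsto_fejerWeight_cube (m : Fin n → ℤ) :
    Filter.Tendsto (fun N : ℕ => fejerWeight (cube n N) m) Filter.atTop (nhds 1) := by
  have h1 : Filter.Tendsto (fun N : ℕ => ∏ i, (((N : ℝ) - |(m i : ℝ)|) / N)) Filter.atTop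
      (nhds (∏ _i : Fin n, (1 : ℝ))) := by
    refine tendsto_finsetProd _ fun i _ => ?_
    have h2 : Filter.Tendsto (fun N : ℕ => 1 - |(m i : ℝ)| / (N : ℝ)) Filter.atTop
        (nhds (1 - 0)) :=
      tendsto_const_nhds.sub (tendsto_const_div_atTop_nhds_zero_nat _)
    rw [sub_zero] at h2
    refine h2.congr' ?_
    filter_upwards [Filter.eventually_gt_atTop 0] with N hN
    have : (N : ℝ) ≠ 0 := by positivity
    field_simp
  rw [Finset.prod_const_one] at h1
  refine tendsto_of_tendsto_of_tendsto_of_le_of_le' h1 tendsto_const_nhds ?_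
    (Filter.Eventually.of_forall fun N => fejerWeight_le_one m)
  have h3 : ∀ i, ∀ᶠ N : ℕ in Filter.atTop, |m i| ≤ (N : ℤ) := fun i => by
    filter_upwards [Filter.eventually_ge_atTop (m i).natAbs] with N hN
    rw [Int.abs_eq_natAbs]
    exact_mod_cast hN
  filter_upwards [Filter.eventually_all.2 h3] with N hN
  exact prod_le_fejerWeight_cube m N hN

end Fourier

/-! ### Norm estimates for Fejér means -/

section Estimates

variable {ω : Fin n → ℝ} [hω : ∀ i, Fact (0 < ω i)] {S : Finset (Fin n → ℤ)}

/-- With truncated subtraction, a bound `‖f‖ₑ ≤ M` almost everywhere says that `‖f‖ₑ - M` has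
integral zero, a condition invariant under translation. -/
lemma IsPeriodic.eLpNorm_top_translate_le {E : Type*} [NormedAddCommGroup E] {f : Rn n → E}
    (hf : IsPeriodic ω f) (hc : Continuous f) (x : Rn n) :
    eLpNorm (fun y => f (x + y)) ∞ (volume.restrict (box ω)) ≤
      eLpNorm f ∞ (volume.restrict (box ω)) := by
  simp only [eLpNorm_exponent_top]
  set M := eLpNormEssSup f (volume.restrict (box ω)) with hM
  have h1 := (hf.comp (fun z => ‖z‖ₑ - M)).setLIntegral_translate x
  have h2 : ∫⁻ y in box ω, (‖f y‖ₑ - M) = 0 := by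
    rw [lintegral_eq_zero_iff (hc.enorm.measurable.sub_const M)]
    filter_upwards [enorm_ae_le_eLpNormEssSup f (volume.restrict (box ω))] with y hy
    exact tsub_eq_zero_of_le hy
  rw [h2, lintegral_eq_zero_iff (f := fun y => ‖f (y + x)‖ₑ - M)
    ((hc.comp (continuous_add_const x)).enorm.measurable.sub_const M)] at h1
  refine eLpNormEssSup_le_of_ae_enorm_bound ?_
  filter_upwards [h1] with y hy
  rw [add_comm]
  exact tsub_eq_zero_iff_le.1 hy

variable (ω S) in
/-- The probability measure on the torus with the Fejér kernel as its density. -/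
def fejerMeasure : Measure (Rn n) :=
  (volume.restrict (box ω)).withDensity fun y => ENNReal.ofReal (fejerKernel ω S y)

lemma isProbabilityMeasure_fejerMeasure (hS : S.Nonempty) :
    IsProbabilityMeasure (fejerMeasure ω S) := by
  constructor
  rw [fejerMeasure, withDensity_apply _ MeasurableSet.univ, Measure.restrict_univ,
    ← ofReal_integral_eq_lintegral_ofReal (integrableOn_box continuous_fejerKernel)
      (Filter.Eventually.of_forall fejerKernel_nonneg), setIntegral_fejerKernel hS,
    ENNReal.ofReal_one]

/-- The kernel is a probability density, so the `L¹` norm against it is at most the `L^q` norm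
(Jensen). -/
lemma enorm_setIntegral_fejerKernel_smul_le {E : Type*} [NormedAddCommGroup E] [NormedSpace ℝ E]
    {f : Rn n → E} (hc : Continuous f) {q : ℝ≥0∞} (hq : 1 ≤ q) (hS : S.Nonempty) :
    ‖∫ y in box ω, fejerKernel ω S y • f y‖ₑ ≤ eLpNorm f q (fejerMeasure ω S) := by
  have := isProbabilityMeasure_fejerMeasure (ω := ω) hS
  refine le_trans ?_ (eLpNorm_le_eLpNorm_of_exponent_le hq hc.aestronglyMeasurable)
  rw [eLpNorm_one_eq_lintegral_enorm, fejerMeasure, lintegral_withDensity_eq_lintegral_mul _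
    (continuous_fejerKernel.measurable.ennreal_ofReal) hc.enorm.measurable]
  refine (enorm_integral_le_lintegral_enorm _).trans_eq (lintegral_congr fun y => ?_)
  rw [enorm_smul, Pi.mul_apply, Real.enorm_eq_ofReal (fejerKernel_nonneg y)]

/-- Averaging translates against a probability measure is a contraction. For finite `q`: Jensen
pointwise, then Tonelli, then translation invariance of the inner integral. -/
lemma eLpNorm_setIntegral_fejerKernel_smul_le {E : Type*} [NormedAddCommGroup E]
    [NormedSpace ℝ E] {f : Rn n → E} (hf : IsPeriodic ω f) (hc : Continuous f) {q : ℝ≥0∞}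
    (hq : 1 ≤ q) (hS : S.Nonempty) :
    eLpNorm (fun x => ∫ y in box ω, fejerKernel ω S y • f (x + y)) q (volume.restrict (box ω)) ≤
      eLpNorm f q (volume.restrict (box ω)) := by
  have := isProbabilityMeasure_fejerMeasure (ω := ω) hS
  have h1 : ∀ x, ‖∫ y in box ω, fejerKernel ω S y • f (x + y)‖ₑ ≤
      eLpNorm (fun y => f (x + y)) q (fejerMeasure ω S) := fun x =>
    enorm_setIntegral_fejerKernel_smul_le (f := fun y => f (x + y))
      (hc.comp (continuous_const_add x)) hq hS
  rcases eq_or_ne q ∞ with rfl | hq'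
  · refine eLpNormEssSup_le_of_ae_enorm_bound (Filter.Eventually.of_forall fun x => ?_)
    refine (h1 x).trans (le_trans ?_ (hf.eLpNorm_top_translate_le hc x))
    simp only [eLpNorm_exponent_top]
    -- The Fejér measure has a density, so its null sets include those of Lebesgue measure on the
    -- box.
    exact eLpNormEssSup_mono_measure _ (withDensity_absolutelyContinuous _ _)
  · have hq0 : q ≠ 0 := (zero_lt_one.trans_le hq).ne'
    have hq1 : 0 < q.toReal := ENNReal.toReal_pos hq0 hq'
    rw [eLpNorm_eq_lintegral_rpow_enorm_toReal hq0 hq',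
      eLpNorm_eq_lintegral_rpow_enorm_toReal hq0 hq']
    refine ENNReal.rpow_le_rpow ?_ (by positivity)
    calc ∫⁻ x in box ω, ‖∫ y in box ω, fejerKernel ω S y • f (x + y)‖ₑ ^ q.toReal
        ≤ ∫⁻ x in box ω, ∫⁻ y, ‖f (x + y)‖ₑ ^ q.toReal ∂fejerMeasure ω S := by
          refine lintegral_mono fun x => ?_
          refine (ENNReal.rpow_le_rpow (h1 x) hq1.le).trans_eq ?_
          rw [eLpNorm_eq_lintegral_rpow_enorm_toReal hq0 hq', ← ENNReal.rpow_mul,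
            one_div_mul_cancel hq1.ne', ENNReal.rpow_one]
      _ = ∫⁻ y, (∫⁻ x in box ω, ‖f (x + y)‖ₑ ^ q.toReal) ∂fejerMeasure ω S := by
          refine lintegral_lintegral_swap (Measurable.aemeasurable ?_)
          exact ((hc.comp continuous_add).enorm.measurable).pow_const _
      _ = ∫⁻ x in box ω, ‖f x‖ₑ ^ q.toReal := by
          simp only [(hf.comp fun z => ‖z‖ₑ ^ q.toReal).setLIntegral_translate]
          rw [lintegral_const, measure_univ, mul_one]

omit hω in
lemma norm_gradient_eq (g : Rn n → ℝ) (x : Rn n) : ‖gradient g x‖ = ‖fderiv ℝ g x‖ :=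
  LinearIsometryEquiv.norm_map _ _

omit hω in
lemma eLpNorm_gradient_eq (g : Rn n → ℝ) (q : ℝ≥0∞) (μ : Measure (Rn n)) :
    eLpNorm (gradient g) q μ = eLpNorm (fderiv ℝ g) q μ :=
  eLpNorm_congr_norm_ae (Filter.Eventually.of_forall (norm_gradient_eq g))

lemma eLpNorm_gradient_fejerMean_le {φ : Rn n → ℝ} (hφ : IsPeriodic ω φ) (h1 : ContDiff ℝ 1 φ)
    {q : ℝ≥0∞} (hq : 1 ≤ q) (hS : S.Nonempty) :
    eLpNorm (gradient (fejerMean ω S φ)) q (volume.restrict (box ω)) ≤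
      eLpNorm (gradient φ) q (volume.restrict (box ω)) := by
  rw [eLpNorm_gradient_eq, eLpNorm_gradient_eq]
  have h : fderiv ℝ (fejerMean ω S φ) =
      fun x => ∫ y in box ω, fejerKernel ω S y • fderiv ℝ φ (x + y) := funext fun x =>
    (hφ.hasFDerivAt_setIntegral h1 continuous_fejerKernel x).fderiv
  rw [h]
  exact eLpNorm_setIntegral_fejerKernel_smul_le hφ.fderiv_right
    (h1.continuous_fderiv one_ne_zero) hq hS

/-! ### The total variation of trigonometric polynomials -/

omit hω in
lemma pairing_neg (a : Dist n) (f : Rn n → ℝ) : pairing ω (-a) f = -pairing ω a f := by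
  rw [pairing, pairing, ← tsum_neg]
  refine tsum_congr fun m => ?_
  simp [pairingTerm]
  ring

/-- Integration by parts followed by Cauchy–Schwarz with `|ψ| ≤ 1`. The sign is that of the
competitor `u - b` in the subgradient inequality. -/
lemma IsTrigPoly.TV_neg_le {F : Finset (Fin n → ℤ)} {h : Dist n} {g : Rn n → ℝ}
    (hg : IsTrigPoly ω F h g) : TV ω (-h) ≤ ((∫ x in box ω, ‖gradient g x‖ : ℝ) : EReal) := by
  refine iSup_le fun ψ => EReal.coe_le_coe_iff.2 ?_
  obtain ⟨ψ, h1, h2, h3⟩ := ψ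
  have hψ1 : ContDiff ℝ 1 ψ := h1.of_le (by exact_mod_cast le_top)
  have hgr := continuous_gradient (hg.contDiff (k := 1))
  rw [pairing_neg, neg_neg, hg.pairing_eq (continuous_divergence hψ1),
    setIntegral_mul_divergence hg.isPeriodic hg.contDiff h2 hψ1, ← integral_neg]
  refine integral_mono (integrableOn_box (hgr.inner hψ1.continuous)).neg
    (integrableOn_box hgr.norm) fun x => ?_
  calc -inner ℝ (gradient g x) (ψ x) ≤ ‖gradient g x‖ * ‖ψ x‖ :=
        (neg_le_abs _).trans (abs_real_inner_le_norm _ _)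
    _ ≤ ‖gradient g x‖ := mul_le_of_le_one_right (norm_nonneg _) (h3 x)

/-- Hölder's inequality against the constant `1`; the exponent of the volume is `1 - 1/p' = 1/p`. -/
lemma ofReal_setIntegral_norm_le {f : Rn n → Rn n} (hf : Continuous f) {p : ℝ≥0∞} (hp : 1 ≤ p)
    (h : eLpNorm f (ENNReal.conjExponent p) (volume.restrict (box ω)) ≤ 1) :
    ENNReal.ofReal (∫ x in box ω, ‖f x‖) ≤ ENNReal.ofReal (vol ω) ^ (p⁻¹).toReal := by
  have hc : ENNReal.HolderConjugate p (ENNReal.conjExponent p) :=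
    ENNReal.HolderConjugate.conjExponent hp
  have hq : 1 ≤ ENNReal.conjExponent p := le_self_add
  have h1 := eLpNorm_le_eLpNorm_mul_rpow_measure_univ (μ := volume.restrict (box ω)) hq
    hf.aestronglyMeasurable
  rw [eLpNorm_one_eq_lintegral_enorm, Measure.restrict_apply_univ, volume_box] at h1
  -- If `p' = ∞`, then `toReal` gives `0` and `1 / 0 = 0`, which is the right value of `1/p'`.
  have h2 : 1 / (1 : ℝ≥0∞).toReal - 1 / (ENNReal.conjExponent p).toReal = (p⁻¹).toReal := by
    have h3 := congrArg ENNReal.toReal hc.inv_add_inv_eq_one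
    rw [ENNReal.toReal_add (ENNReal.inv_ne_top.2 (zero_lt_one.trans_le hp).ne')
      (ENNReal.inv_ne_top.2 (zero_lt_one.trans_le hq).ne'), ENNReal.toReal_one] at h3
    rw [ENNReal.toReal_one, one_div_one, one_div, ← ENNReal.toReal_inv]
    linarith
  rw [h2] at h1
  rw [ofReal_integral_norm_eq_lintegral_enorm (integrableOn_box hf)]
  exact h1.trans (mul_le_of_le_one_left' h)

end Estimates

/-! ### Decay of Fourier coefficients -/

section Decay

variable {ω : Fin n → ℝ} [hω : ∀ i, Fact (0 < ω i)]

omit hω in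
lemma hasFDerivAt_char (m : Fin n → ℤ) (x : Rn n) :
    HasFDerivAt (char ω m)
      ((char ω m x * Complex.I) • (Complex.ofRealCLM.comp (innerSL ℝ (wave ω m)))) x := by
  have h := ((Complex.ofRealCLM.comp (innerSL ℝ (wave ω m))).hasFDerivAt (x := x)).const_mul
    Complex.I
  have h2 := h.cexp
  rw [smul_smul] at h2
  exact h2

/-- The derivative of `char ω (-m) * f` integrates to zero over the torus; expand it by the product
rule. -/
lemma fourierCoef_fderiv {f : Rn n → ℝ} (hf : IsPeriodic ω f) (h1 : ContDiff ℝ 1 f)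
    (m : Fin n → ℤ) (i : Fin n) :
    fourierCoef ω (fun x => fderiv ℝ f x (EuclideanSpace.single i 1)) m =
      Complex.I * (wave ω m i : ℝ) * fourierCoef ω f m := by
  set e : Rn n := EuclideanSpace.single i 1 with he
  have hfd : Continuous (fderiv ℝ f) := h1.continuous_fderiv one_ne_zero
  have hfc := h1.continuous
  have hchar := continuous_char ω (-m)
  have hd : ∀ x, HasFDerivAt (fun x => (f x : ℂ)) (Complex.ofRealCLM.comp (fderiv ℝ f x)) x :=
    fun x => Complex.ofRealCLM.hasFDerivAt.comp x
      (h1.differentiable one_ne_zero x).hasFDerivAt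
  have hprod := fun x => (hasFDerivAt_char (ω := ω) (-m) x).fun_mul (hd x)
  have hper : IsPeriodic ω fun x => char ω (-m) x * (f x : ℂ) :=
    (isPeriodic_char (ω := ω) (-m)).comp₂ hf fun a b => a * (b : ℂ)
  have hC1 : ContDiff ℝ 1 fun x => char ω (-m) x * (f x : ℂ) := by
    refine ContDiff.mul ?_ (Complex.ofRealCLM.contDiff.comp h1)
    unfold char
    exact Complex.contDiff_exp.comp (contDiff_const.mul
      (Complex.ofRealCLM.contDiff.comp (contDiff_const.inner ℝ contDiff_id)))
  have h0 := hper.setIntegral_fderiv hC1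
  have h2 := congrArg (fun L : Rn n →L[ℝ] ℂ => L e) h0
  rw [ContinuousLinearMap.integral_apply
    (integrableOn_box (hC1.continuous_fderiv one_ne_zero))] at h2
  have h3 : ∀ x, fderiv ℝ (fun x => char ω (-m) x * (f x : ℂ)) x e =
      char ω (-m) x * (fderiv ℝ f x e : ℝ) -
        Complex.I * (wave ω m i : ℝ) * (char ω (-m) x * f x) := fun x => by
    rw [(hprod x).fderiv]
    simp [he, wave_neg, EuclideanSpace.inner_single_right]
    ring
  simp only [h3, zero_apply] at h2
  rw [integral_sub (f := fun x => char ω (-m) x * (fderiv ℝ f x e : ℝ))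
    (integrableOn_box (by fun_prop)) (integrableOn_box (by fun_prop)), sub_eq_zero,
    integral_const_mul] at h2
  rw [fourierCoef_eq, fourierCoef_eq, h2]
  ring

lemma exists_norm_fourierCoef_le {f : Rn n → ℝ} (hf : IsPeriodic ω f) (hc : Continuous f) :
    ∃ C, ∀ m, ‖fourierCoef ω f m‖ ≤ C := by
  obtain ⟨C, hC⟩ := hf.exists_bound hc
  refine ⟨‖(((vol ω)⁻¹ : ℝ) : ℂ)‖ * (C * volume.real (box ω)), fun m => ?_⟩
  rw [fourierCoef_eq, norm_mul]
  refine mul_le_mul_of_nonneg_left ?_ (norm_nonneg _)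
  refine norm_setIntegral_le_of_norm_le_const (by rw [volume_box]; exact ENNReal.ofReal_lt_top)
    fun x _ => ?_
  rw [norm_mul, Complex.norm_real, char, mul_comm Complex.I, Complex.norm_exp_ofReal_mul_I,
    one_mul]
  exact hC x

lemma exists_abs_wave_pow_mul_norm_fourierCoef_le {f : Rn n → ℝ} (hf : IsPeriodic ω f)
    (h : ContDiff ℝ (⊤ : ℕ∞) f) (i : Fin n) (N : ℕ) :
    ∃ C, ∀ m, |wave ω m i| ^ N * ‖fourierCoef ω f m‖ ≤ C := by
  induction N generalizing f with
  | zero => simpa using exists_norm_fourierCoef_le hf h.continuous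
  | succ N ih =>
    have h1 : ContDiff ℝ 1 f := h.of_le (by exact_mod_cast le_top)
    obtain ⟨C, hC⟩ := ih (hf.fderiv_right.comp fun L => L (EuclideanSpace.single i 1))
      ((h.fderiv_right (m := (⊤ : ℕ∞)) (by simp)).clm_apply contDiff_const)
    refine ⟨C, fun m => le_of_eq_of_le ?_ (hC m)⟩
    rw [fourierCoef_fderiv hf h1, norm_mul, norm_mul, Complex.norm_I, Complex.norm_real, one_mul,
      Real.norm_eq_abs, pow_succ]
    ring

omit hω in
lemma norm_le_sum_abs (x : Rn n) : ‖x‖ ≤ ∑ i, |x i| := by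
  have h : x = ∑ i, x i • EuclideanSpace.single i (1 : ℝ) := by
    ext j
    simp [Pi.single_apply]
  nth_rw 1 [h]
  refine (norm_sum_le _ _).trans_eq (Finset.sum_congr rfl fun i _ => ?_)
  simp [norm_smul]

lemma exists_norm_wave_pow_mul_norm_fourierCoef_le {f : Rn n → ℝ} (hf : IsPeriodic ω f)
    (h : ContDiff ℝ (⊤ : ℕ∞) f) (N : ℕ) :
    ∃ C, ∀ m, ‖wave ω m‖ ^ (N + 1) * ‖fourierCoef ω f m‖ ≤ C := by
  choose C hC using fun i => exists_abs_wave_pow_mul_norm_fourierCoef_le hf h i (N + 1)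
  refine ⟨(n : ℝ) ^ N * ∑ i, C i, fun m => ?_⟩
  have h1 : ‖wave ω m‖ ^ (N + 1) ≤ (n : ℝ) ^ N * ∑ i, |wave ω m i| ^ (N + 1) := by
    refine (pow_le_pow_left₀ (norm_nonneg _) (norm_le_sum_abs _) _).trans ?_
    rcases n.eq_zero_or_pos with rfl | hn
    · simp
    -- The power mean inequality `(∑ xᵢ)^(N+1) ≤ n^N ∑ xᵢ^(N+1)` is the source of the factor `n ^
    -- N`.
    have h2 := pow_sum_div_card_le_sum_pow (s := Finset.univ) (f := fun i => |wave ω m i|)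
      (fun i _ => abs_nonneg _) N
    rwa [Finset.card_univ, Fintype.card_fin, div_le_iff₀' (by positivity)] at h2
  refine (mul_le_mul_of_nonneg_right h1 (norm_nonneg _)).trans ?_
  rw [mul_assoc, Finset.sum_mul]
  exact mul_le_mul_of_nonneg_left (Finset.sum_le_sum fun i _ => hC i m) (by positivity)

/-- The wave vectors lie, without repetition, in the lattice with periods `2π / ω i`, where such
sums converge for exponents below minus the rank. Only the existence of a threshold matters. -/
lemma exists_summable_norm_wave_rpow :
    ∃ R : ℝ, ∀ r < R, Summable fun m : Fin n → ℤ => ‖wave ω m‖ ^ r := by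
  obtain ⟨b, hb⟩ : ∃ b : Module.Basis (Fin n) ℝ (Rn n),
      ∀ i, b i = EuclideanSpace.single i (2 * Real.pi / ω i) := by
    have hω' : ∀ i, Fact (0 < 2 * Real.pi / ω i) := fun i =>
      ⟨div_pos Real.two_pi_pos (hω i).out⟩
    exact ⟨_, periodBasis_apply fun i => 2 * Real.pi / ω i⟩
  let L := Submodule.span ℤ (Set.range b)
  refine ⟨-Module.finrank ℤ L, fun r hr => ?_⟩
  have h1 : ∀ m, wave ω m = ∑ i, m i • b i := fun m => by
    ext j
    simp [hb, wave, Pi.single_apply]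
    ring
  have h2 : ∀ m, wave ω m ∈ L := fun m => by
    rw [h1]
    exact sum_mem fun i _ => Submodule.smul_mem _ _ (Submodule.subset_span ⟨i, rfl⟩)
  have h3 : Function.Injective fun m => (⟨wave ω m, h2 m⟩ : L) := fun m l hml => by
    rw [← sub_eq_zero]
    by_contra hne
    refine wave_ne_zero ω hne ?_
    rw [sub_eq_add_neg, wave_add, wave_neg, ← sub_eq_add_neg, sub_eq_zero]
    exact congrArg Subtype.val hml
  have h4 := (ZLattice.summable_norm_rpow L r hr).comp_injective h3
  refine h4.congr fun m => ?_
  simp only [Function.comp_apply, Submodule.coe_norm]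

/-- The pairing of an element of a homogeneous Sobolev space with a smooth function on the torus
converges absolutely. -/
lemma HDot.summable_pairingTerm {σ : ℝ} (a : HDot ω σ) {f : Rn n → ℝ} (hf : IsPeriodic ω f)
    (h : ContDiff ℝ (⊤ : ℕ∞) f) : Summable (pairingTerm ω a.coef f) := by
  obtain ⟨R, hR⟩ := exists_summable_norm_wave_rpow (ω := ω)
  obtain ⟨N, hN⟩ := exists_nat_gt (-R - 2 * σ)
  obtain ⟨C, hC⟩ := exists_norm_wave_pow_mul_norm_fourierCoef_le hf h N
  have hr : -2 * σ - 2 * (N + 1 : ℝ) < R := by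
    have : (0 : ℝ) ≤ N := Nat.cast_nonneg N
    linarith
  -- Each term is split as `(|k|^σ |a m|) (|k|^(-σ) |f m|)` and bounded by the sum of the squares.
  -- The first square is summable by membership in the Sobolev space, the second by the choice of
  -- `N`.
  refine Summable.of_norm_bounded (((a.2.2.2 : Summable fun m =>
    ‖wave ω m‖ ^ (2 * σ) * ‖a.coef m‖ ^ 2).add ((hR _ hr).mul_left (C ^ 2))).mul_left (vol ω))
    fun m => ?_
  have hv := (vol_pos ω).le
  rw [pairingTerm, norm_mul, Real.norm_of_nonneg hv]
  refine mul_le_mul_of_nonneg_left ?_ hv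
  by_cases hm : m = 0
  · rw [hm, HDot.coef_zero, zero_mul, Complex.zero_re, norm_zero]
    positivity
  refine (Complex.abs_re_le_norm _).trans ?_
  rw [norm_mul, RCLike.norm_conj]
  have hk : 0 < ‖wave ω m‖ := norm_pos_iff.2 (wave_ne_zero ω hm)
  set k := ‖wave ω m‖
  have h1 : k ^ (2 * σ) = (k ^ σ) ^ 2 := by
    rw [mul_comm, Real.rpow_mul hk.le]; norm_num
  have h2 : k ^ (-2 * σ - 2 * (N + 1 : ℝ)) = (k ^ (-σ) / k ^ (N + 1)) ^ 2 := by
    rw [← Real.rpow_natCast k (N + 1), ← Real.rpow_sub hk, ← Real.rpow_natCast _ 2,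
      ← Real.rpow_mul hk.le]
    push_cast
    ring_nf
  have h3 : k ^ σ * k ^ (-σ) = 1 := by rw [← Real.rpow_add hk, add_neg_cancel, Real.rpow_zero]
  have h4 : ‖fourierCoef ω f m‖ ≤ C / k ^ (N + 1) := by
    rw [le_div_iff₀ (pow_pos hk _), mul_comm]; exact hC m
  have h5 : ‖a.coef m‖ * ‖fourierCoef ω f m‖ =
      (k ^ σ * ‖a.coef m‖) * (k ^ (-σ) * ‖fourierCoef ω f m‖) := by
    linear_combination -‖a.coef m‖ * ‖fourierCoef ω f m‖ * h3
  have h6 : k ^ (-σ) * ‖fourierCoef ω f m‖ ≤ C * (k ^ (-σ) / k ^ (N + 1)) := by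
    refine (mul_le_mul_of_nonneg_left h4 (by positivity)).trans_eq (by ring)
  have h7 : 0 ≤ k ^ (-σ) * ‖fourierCoef ω f m‖ := by positivity
  rw [h5, h1, h2, ← mul_pow, ← mul_pow]
  change _ ≤ (k ^ σ * ‖a.coef m‖) ^ 2 + _
  nlinarith [sq_nonneg (k ^ σ * ‖a.coef m‖ - k ^ (-σ) * ‖fourierCoef ω f m‖),
    pow_le_pow_left₀ h7 h6 2, sq_nonneg (k ^ σ * ‖a.coef m‖)]

end Decay

/-! ### The flow tested against trigonometric polynomials -/

section Flow

variable {ω : Fin n → ℝ}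

/-- The zero field competes. This excludes the value `⊥`, so a finite `TV` can be cancelled in
`EReal`. -/
lemma TV_nonneg (a : Dist n) : 0 ≤ TV ω a := by
  refine le_iSup_of_le ⟨fun _ => 0, contDiff_const, fun _ _ => rfl, fun x => by simp⟩ ?_
  have h : divergence (fun _ : Rn n => (0 : Rn n)) = fun _ => 0 := by
    funext x
    simp [divergence]
  simp [h, pairing, pairingTerm, fourierCoef]

lemma pairingTerm_add (a b : Dist n) (f : Rn n → ℝ) :
    pairingTerm ω (a + b) f = pairingTerm ω a f + pairingTerm ω b f := by
  funext m
  simp [pairingTerm]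
  ring

lemma IsPeriodic.divergence {ψ : Rn n → Rn n} (hψ : IsPeriodic ω ψ) :
    IsPeriodic ω (divergence ψ) :=
  hψ.fderiv_right.comp fun L => ∑ i, L (EuclideanSpace.single i 1) i

lemma contDiff_divergence {ψ : Rn n → Rn n} (hψ : ContDiff ℝ (⊤ : ℕ∞) ψ) :
    ContDiff ℝ (⊤ : ℕ∞) (divergence ψ) := by
  unfold TVFlow.divergence
  have h : ContDiff ℝ (⊤ : ℕ∞) (fderiv ℝ ψ) := hψ.fderiv_right (by simp)
  fun_prop

variable [hω : ∀ i, Fact (0 < ω i)]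

/-- A supremum of additive functionals is subadditive. The pairing is a `tsum`, additive only
because both series converge, hence the restriction to Sobolev elements. -/
lemma TV_add_le {σ : ℝ} (a b : HDot ω σ) :
    TV ω (a + b).coef ≤ TV ω a.coef + TV ω b.coef := by
  refine iSup_le fun ψ => ?_
  have hper : IsPeriodic ω (TVFlow.divergence ψ.1) := ψ.2.2.1.divergence
  have hs := contDiff_divergence ψ.2.1
  have h : pairing ω (a + b).coef (divergence ψ.1) =
      pairing ω a.coef (divergence ψ.1) + pairing ω b.coef (divergence ψ.1) := by
    change pairing ω (a.coef + b.coef) _ = _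
    simp only [pairing, pairingTerm_add]
    exact (a.summable_pairingTerm hper hs).tsum_add (b.summable_pairingTerm hper hs)
  rw [h, neg_add, EReal.coe_add]
  exact add_le_add (le_iSup (fun ψ : {φ : Rn n → Rn n // ContDiff ℝ (⊤ : ℕ∞) φ ∧
    IsPeriodic ω φ ∧ ∀ x, ‖φ x‖ ≤ 1} => ((-pairing ω a.coef (divergence ψ.1) : ℝ) : EReal)) ψ)
    (le_iSup (fun ψ : {φ : Rn n → Rn n // ContDiff ℝ (⊤ : ℕ∞) φ ∧
    IsPeriodic ω φ ∧ ∀ x, ‖φ x‖ ≤ 1} => ((-pairing ω b.coef (divergence ψ.1) : ℝ) : EReal)) ψ)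

/-- An average-free real finite Fourier sum as an element of the Sobolev space. -/
def finiteSum (σ : ℝ) (h : Dist n) (F : Finset (Fin n → ℤ)) (hF : ∀ m, m ∉ F → h m = 0)
    (h0 : h 0 = 0) (hr : ∀ m, h (-m) = starRingEnd ℂ (h m)) : HDot ω σ :=
  ⟨h, h0, hr, summable_of_ne_finset_zero (s := F) fun m hm => by simp [hF m hm]⟩

/-- The bridge between the Hilbert space of the flow and the dual norm to be estimated. -/
lemma pairing_fracLap {σ : ℝ} (a b : HDot ω σ) {g : Rn n → ℝ} (hg : fourierCoef ω g = b.coef) :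
    pairing ω (fracLap ω σ a.coef) g = inner ℝ b a := by
  rw [real_inner_comm, HDot.inner_def, ← tsum_mul_left]
  refine tsum_congr fun m => ?_
  rw [pairingTerm, hg, fracLap]
  split_ifs with hm
  · simp [hm, HDot.coef_zero]
  · rw [mul_assoc, Complex.re_ofReal_mul]

/-- Compare `u` with `u - b`: subadditivity replaces `TV (u - b)` by `TV u + TV (-b)`, and the
finite number `TV u` cancels. -/
lemma inner_le_of_neg_mem_subdifferential {σ : ℝ} {v u b : HDot ω σ} {F : Finset (Fin n → ℤ)}
    {g : Rn n → ℝ} (hg : IsTrigPoly ω F b.coef g)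
    (hv : -v ∈ subdifferential (fun w : HDot ω σ => TV ω w.coef) u) :
    inner ℝ b v ≤ ∫ x in box ω, ‖gradient g x‖ := by
  obtain ⟨htop, h⟩ := hv
  have h1 := (h (-b)).trans (TV_add_le u (-b))
  have h2 := h1.trans (add_le_add_right hg.TV_neg_le _)
  have h3 : TV ω u.coef ≠ ⊥ := (EReal.bot_lt_zero.trans_le (TV_nonneg _)).ne'
  lift TV ω u.coef to ℝ using ⟨htop.ne, h3⟩ with r
  rw [inner_neg_neg] at h2
  have h4 : r + inner ℝ b v ≤ r + ∫ x in box ω, ‖gradient g x‖ := by exact_mod_cast h2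
  linarith

/-- The pointwise bound on `u_t` is integrated over `(δ, t)`, as `u_t` is only known to be square
integrable away from time `0`; then `δ → 0` by continuity of `u`. -/
lemma IsSolution.inner_le {s : ℝ} {u₀ : HDot ω (-s)} {u : ℝ → HDot ω (-s)}
    (hu : IsSolution ω s u₀ u) {b : HDot ω (-s)} {F : Finset (Fin n → ℤ)} {g : Rn n → ℝ}
    (hg : IsTrigPoly ω F b.coef g) {t : ℝ} (ht : 0 ≤ t) :
    inner ℝ b (u t) ≤ (∫ x in box ω, ‖gradient g x‖) * t + inner ℝ b u₀ := by
  set M := ∫ x in box ω, ‖gradient g x‖ with hM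
  obtain ⟨v, hv1, hv2, hv3⟩ := hu.flow
  rcases ht.eq_or_lt with rfl | ht
  · rw [hu.initial, mul_zero, zero_add]
  have hM0 : 0 ≤ M := integral_nonneg fun _ => norm_nonneg _
  have key : ∀ δ ∈ Set.Ioo 0 t, inner ℝ b (u t) ≤ M * t + inner ℝ b (u δ) := by
    intro δ hδ
    have hint : IntervalIntegrable v volume δ t := by
      rw [intervalIntegrable_iff_integrableOn_Ioc_of_le hδ.2.le]
      have h1 : MemLp v 2 (volume.restrict (Set.Ioc δ t)) :=
        (hv1 δ hδ.1).mono_measure (Measure.restrict_mono Set.Ioc_subset_Ioi_self le_rfl)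
      exact h1.integrable one_le_two
    have h2 : inner ℝ b (u t) - inner ℝ b (u δ) = ∫ τ in δ..t, inner ℝ b (v τ) := by
      rw [← inner_sub_right, hv2 δ t hδ.1 hδ.2.le]
      exact ((innerSL ℝ b).intervalIntegral_comp_comm hint).symm
    have h3 : ∫ τ in δ..t, inner ℝ b (v τ) ≤ ∫ _τ in δ..t, M := by
      refine intervalIntegral.integral_mono_ae_restrict hδ.2.le ?_ intervalIntegrable_const ?_
      · exact ⟨hint.1.const_inner b, hint.2.const_inner b⟩
      · have h4 := ae_restrict_of_ae_restrict_of_subset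
          (fun τ hτ => hδ.1.trans_le hτ.1 : Set.Icc δ t ⊆ Set.Ioi 0) hv3
        filter_upwards [h4] with τ hτ
        exact inner_le_of_neg_mem_subdifferential hg hτ
    rw [intervalIntegral.integral_const, smul_eq_mul] at h3
    nlinarith [hδ.1]
  have hlim : Filter.Tendsto (fun δ => M * t + inner ℝ b (u δ)) (nhdsWithin 0 (Set.Ioi 0))
      (nhds (M * t + inner ℝ b u₀)) := by
    have h1 : Filter.Tendsto u (nhdsWithin 0 (Set.Ioi 0)) (nhds (u 0)) :=
      (hu.continuousOn 0 Set.self_mem_Ici).mono_left (nhdsWithin_mono _ Set.Ioi_subset_Ici_self)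
    rw [hu.initial] at h1
    exact tendsto_const_nhds.add (tendsto_const_nhds.inner h1)
  refine ge_of_tendsto hlim ?_
  filter_upwards [Ioo_mem_nhdsGT ht] with δ hδ using key δ hδ

/-- The Fejér mean multiplies each term by a weight in `[0, 1]` tending to `1`, so the original
series dominates. -/
lemma tendsto_pairing_fejerMean {φ : Rn n → ℝ} (hφ : IsPeriodic ω φ) (hc : Continuous φ)
    {w : Dist n} (hw : Summable (pairingTerm ω w φ)) :
    Filter.Tendsto (fun N => pairing ω w (fejerMean ω (cube n N) φ)) Filter.atTop
      (nhds (pairing ω w φ)) := by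
  have h : ∀ N m, pairingTerm ω w (fejerMean ω (cube n N) φ) m =
      fejerWeight (cube n N) m * pairingTerm ω w φ m := fun N m => by
    simp only [pairingTerm, (isTrigPoly_fejerMean hφ hc).fourierCoef_eq, map_mul,
      Complex.conj_ofReal]
    rw [mul_left_comm (w m), Complex.re_ofReal_mul]
    ring
  refine tendsto_tsum_of_dominated_convergence hw.norm (fun m => ?_)
    (Filter.Eventually.of_forall fun N m => ?_)
  · simp only [h]
    have h1 := (tendsto_fejerWeight_cube m).mul_const (pairingTerm ω w φ m)
    rwa [one_mul] at h1
  · rw [h, norm_mul, Real.norm_of_nonneg (fejerWeight_nonneg m)]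
    exact mul_le_of_le_one_left (norm_nonneg _) (fejerWeight_le_one m)

end Flow
end

end TVFlow

/-! ### The growth estimate in the negative Sobolev norm -/

open TVFlow in
theorem mainTheorem5 {n : ℕ} (ω : Fin n → ℝ) [∀ i, Fact (0 < ω i)] (s : ℝ)
    (u₀ : TVFlow.HDot ω (-s)) (u : ℝ → TVFlow.HDot ω (-s)) (hu : TVFlow.IsSolution ω s u₀ u)
    (p : ENNReal) (hp : 1 ≤ p) (t : ℝ) (ht : 0 ≤ t) :
    TVFlow.negSobolevNorm ω p (TVFlow.fracLap ω (-s) (u t).coef) ≤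
      ENNReal.ofReal (TVFlow.vol ω) ^ (p⁻¹).toReal * ENNReal.ofReal t +
        TVFlow.negSobolevNorm ω p (TVFlow.fracLap ω (-s) u₀.coef) := by
  refine iSup_le fun φ => ?_
  obtain ⟨φ, h1, hper, hmean, hgrad, hsum⟩ := φ
  -- The pairing with `φ` is the limit of the pairings with its Fejér means, so it suffices to bound
  -- these.
  refine le_of_tendsto (ENNReal.tendsto_ofReal
    (tendsto_pairing_fejerMean hper h1.continuous hsum)) ?_
  filter_upwards [Filter.eventually_gt_atTop 0] with N hN
  have hS : (cube n N).Nonempty := Finset.card_pos.1 (by rw [card_cube]; positivity)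
  set g := fejerMean ω (cube n N) φ with hgdef
  have hg := isTrigPoly_fejerMean (S := cube n N) hper h1.continuous
  have hgper : IsPeriodic ω g := hg.isPeriodic
  have hg1 : ContDiff ℝ 1 g := hg.contDiff
  have hq : 1 ≤ ENNReal.conjExponent p := le_self_add
  have hggrad := (eLpNorm_gradient_fejerMean_le hper h1 hq hS).trans hgrad
  have hφ0 : fourierCoef ω φ 0 = 0 := by simp [fourierCoef_zero, hmean]
  have hg0 : fourierCoef ω g 0 = 0 := by rw [hg.fourierCoef_eq]; simp [hφ0]
  have hgmean : ∫ x in box ω, g x = 0 := by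
    rw [fourierCoef_zero, Complex.ofReal_eq_zero] at hg0
    exact (mul_eq_zero.1 hg0).resolve_left (inv_ne_zero (vol_pos ω).ne')
  -- Written as Fourier coefficients of the real function `g`, the coefficients have the Hermitian
  -- symmetry required in `HDot`.
  rw [← hg.fourierCoef_eq] at hg
  let b : HDot ω (-s) := finiteSum (-s) (fourierCoef ω g) _ hg.eq_zero hg0 (fourierCoef_neg g)
  have hb : IsTrigPoly ω _ b.coef g := hg
  have hle := hu.inner_le hb ht
  rw [← pairing_fracLap (u t) b (g := g) rfl, ← pairing_fracLap u₀ b (g := g) rfl] at hle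
  refine (ENNReal.ofReal_le_ofReal hle).trans (ENNReal.ofReal_add_le.trans (add_le_add ?_ ?_))
  · rw [ENNReal.ofReal_mul' ht]
    exact mul_le_mul_left (ofReal_setIntegral_norm_le (continuous_gradient hg1) hp hggrad) _
  · exact le_iSup (fun φ : {φ : Rn n → ℝ // ContDiff ℝ 1 φ ∧ IsPeriodic ω φ ∧
      ∫ x in box ω, φ x = 0 ∧
      eLpNorm (gradient φ) (ENNReal.conjExponent p) (volume.restrict (box ω)) ≤ 1 ∧
      Summable (pairingTerm ω (fracLap ω (-s) u₀.coef) φ)} =>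
      ENNReal.ofReal (pairing ω (fracLap ω (-s) u₀.coef) φ.1))
      ⟨g, hg1, hgper, hgmean, hggrad, hg.summable_pairingTerm _⟩
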